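/- Let $k$ be a field that is complete with respect to a non-trivial discrete non-Archimedean absolute value, with residue field $\widetilde{k}$, and let $k'/k$ be a finite Galois extension, endowed with the unique absolute value extending that of $k$. Assume that $k'/k$ is totally ramified, i.e. that $[|k'^{\times}| : |k^{\times}|] = [k':k]$. For $K \in \{k, k'\}$, let $\mathcal{B}(\mathrm{SL}_2, K)$ be the Bruhat--Tits building of $\mathrm{SL}_2$ over $K$, realized as the set of homothety classes of diagonalizable norms on $K^2$, i.e. of norms of the form $\lambda_0 e_0 + \lambda_1 e_1 \mapsto \max(\exp(c_0)|\lambda_0|, \exp(c_1)|\lambda_1|)$ for some basis $(e_0,e_1)$ of $K^2$ and some $c_0, c_1 \in \mathbf{R}$. The group $\mathrm{Gal}(k'/k)$ acts on $\mathcal{B}(\mathrm{SL}_2,k')$ by $\sigma\cdot[N] = [N \circ \sigma^{-1}]$, where $\sigma^{-1}$ acts coordinatewise on $k'^2$, and there is a natural map $\mathcal{B}(\mathrm{SL}_2,k) \to \mathcal{B}(\mathrm{SL}_2,k')$, $[N] \mapsto [N_{k'}]$, given by extension of scalars of norms: $N_{k'}(w) = \inf \max_i |a_i| N(x_i)$,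 the infimum being taken over all finite expressions $w = \sum_i a_i x_i$ with $a_i \in k'$ and $x_i \in k^2$. Then this natural map is injective and its image is contained in the set $\mathcal{B}(\mathrm{SL}_2,k')^{\mathrm{Gal}(k'/k)}$ of Galois-fixed points. Identifying $\mathcal{B}(\mathrm{SL}_2,k)$ with its image, $$\mathcal{B}(\mathrm{SL}_2,k) \subsetneq \mathcal{B}(\mathrm{SL}_2,k')^{\mathrm{Gal}(k'/k)} \iff [k':k] \text{ is divisible by the characteristic of } \widetilde{k}$$ (if $\widetilde{k}$ has characteristic $0$, the right-hand side is false). -/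

import Mathlib

namespace GoldmanIwahori

noncomputable section

open Module
open scoped Pointwise

section Norms

variable {n : ℕ} {K : Type*} [NormedField K]

/-- The function `∑ i, λ i • b i ↦ max_i exp (c i) * |λ i|` attached to a basis `b` of `K ^ n`
and to `c ∈ ℝ ^ n`. -/
def diagFun (b : Basis (Fin n) K (Fin n → K)) (c : Fin n → ℝ) (v : Fin n → K) : ℝ :=
  ⨆ i, Real.exp (c i) * ‖b.repr v i‖

theorem le_diagFun (b : Basis (Fin n) K (Fin n → K)) (c : Fin n → ℝ) (v : Fin n → K)
    (i : Fin n) : Real.exp (c i) * ‖b.repr v i‖ ≤ diagFun b c v :=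
  le_ciSup (f := fun i => Real.exp (c i) * ‖b.repr v i‖) (Set.finite_range _).bddAbove i

theorem diagFun_nonneg (b : Basis (Fin n) K (Fin n → K)) (c : Fin n → ℝ) (v : Fin n → K) :
    0 ≤ diagFun b c v :=
  Real.iSup_nonneg fun i => by positivity

theorem diagFun_le {b : Basis (Fin n) K (Fin n → K)} {c : Fin n → ℝ} {v : Fin n → K} {r : ℝ}
    (hr : 0 ≤ r) (h : ∀ i, Real.exp (c i) * ‖b.repr v i‖ ≤ r) : diagFun b c v ≤ r :=
  Real.iSup_le h hr

theorem diagFun_smul (b : Basis (Fin n) K (Fin n → K)) (c : Fin n → ℝ) (a : K)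
    (v : Fin n → K) : diagFun b c (a • v) = ‖a‖ * diagFun b c v := by
  unfold diagFun
  rw [Real.mul_iSup_of_nonneg (norm_nonneg a)]
  congr 1
  ext i
  simp only [map_smul, Finsupp.smul_apply, smul_eq_mul, norm_mul]
  ring

theorem diagFun_basis (b : Basis (Fin n) K (Fin n → K)) (c : Fin n → ℝ) (i : Fin n) :
    diagFun b c (b i) = Real.exp (c i) := by
  apply le_antisymm
  · refine diagFun_le (Real.exp_pos _).le fun j => ?_
    by_cases h : i = j
    · subst h; simp
    · simp [h, (Real.exp_pos (c i)).le]
  · simpa using le_diagFun b c (b i) i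

/-- The norm on `K ^ n` diagonalized by the basis `b` with parameters `c`. -/
def diagSeminorm [IsUltrametricDist K] (b : Basis (Fin n) K (Fin n → K)) (c : Fin n → ℝ) :
    Seminorm K (Fin n → K) :=
  Seminorm.of (diagFun b c)
    (fun v w => by
      refine diagFun_le (add_nonneg (diagFun_nonneg b c v) (diagFun_nonneg b c w)) fun i => ?_
      calc Real.exp (c i) * ‖b.repr (v + w) i‖
          ≤ Real.exp (c i) * (‖b.repr v i‖ + ‖b.repr w i‖) := by
            gcongr
            simpa using norm_add_le (b.repr v i) (b.repr w i)
        _ ≤ diagFun b c v + diagFun b c w := by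
            rw [mul_add]
            exact add_le_add (le_diagFun b c v i) (le_diagFun b c w i))
    (diagFun_smul b c)

/-- `N` is diagonalizable: some basis of `K ^ n` is adapted to it. Over a non-Archimedean field
such an `N` is automatically a non-Archimedean norm, i.e. it is ultrametric and it vanishes only
at the origin (see `IsDiagonalizable.add_le_max` and `IsDiagonalizable.eq_zero`). -/
def IsDiagonalizable (N : Seminorm K (Fin n → K)) : Prop :=
  ∃ (b : Basis (Fin n) K (Fin n → K)) (c : Fin n → ℝ), ∀ v, N v = diagFun b c v

theorem IsDiagonalizable.add_le_max [IsUltrametricDist K] {N : Seminorm K (Fin n → K)}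
    (hN : IsDiagonalizable N) (v w : Fin n → K) : N (v + w) ≤ max (N v) (N w) := by
  obtain ⟨b, c, h⟩ := hN
  simp only [h]
  refine diagFun_le (le_max_of_le_left (diagFun_nonneg b c v)) fun i => ?_
  have h1 : ‖b.repr (v + w) i‖ ≤ max ‖b.repr v i‖ ‖b.repr w i‖ := by
    simpa using IsUltrametricDist.norm_add_le_max (b.repr v i) (b.repr w i)
  rcases le_max_iff.1 h1 with h2 | h2
  · exact le_max_of_le_left
      ((mul_le_mul_of_nonneg_left h2 (Real.exp_pos _).le).trans (le_diagFun b c v i))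
  · exact le_max_of_le_right
      ((mul_le_mul_of_nonneg_left h2 (Real.exp_pos _).le).trans (le_diagFun b c w i))

theorem IsDiagonalizable.eq_zero {N : Seminorm K (Fin n → K)}
    (hN : IsDiagonalizable N) {v : Fin n → K} (hv : N v = 0) : v = 0 := by
  obtain ⟨b, c, h⟩ := hN
  rw [h] at hv
  apply b.repr.injective
  ext i
  have h1 := le_diagFun b c v i
  rw [hv] at h1
  have h2 : ‖b.repr v i‖ ≤ 0 := by
    by_contra h3
    exact absurd h1 (not_le.2 (mul_pos (Real.exp_pos _) (not_le.1 h3)))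
  simpa using h2

variable (n K) in
/-- The space of diagonalizable norms on `K ^ n`. -/
def DiagNorms : Type _ := {N : Seminorm K (Fin n → K) // IsDiagonalizable N}

variable (n K) in
/-- Homothety: `N ∼ N'` if `N = a * N'` for some real number `a > 0`. -/
def homothety : Setoid (DiagNorms n K) where
  r N N' := ∃ a : ℝ, 0 < a ∧ ∀ v, N.1 v = a * N'.1 v
  iseqv :=
    { refl := fun N => ⟨1, one_pos, fun v => (one_mul _).symm⟩
      symm := by
        rintro N N' ⟨a, ha, h⟩
        exact ⟨a⁻¹, inv_pos.2 ha, fun v => by rw [h, inv_mul_cancel_left₀ ha.ne']⟩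
      trans := by
        rintro N N' N'' ⟨a, ha, h⟩ ⟨a', ha', h'⟩
        exact ⟨a * a', mul_pos ha ha', fun v => by rw [h, h', mul_assoc]⟩ }

variable (n K) in
/-- The Bruhat-Tits building `B(SL_n, K)`: homothety classes of diagonalizable norms
on `K ^ n`. -/
def Building : Type _ := Quotient (homothety n K)

end Norms

section BaseChange

variable {n : ℕ} {k k' : Type*} [NormedField k] [NormedField k'] [NormedAlgebra k k']

/-- The basis of `k' ^ n` given by the vectors of a basis of `k ^ n`. -/
def extendBasis (k' : Type*) [NormedField k'] [NormedAlgebra k k']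
    (b : Basis (Fin n) k (Fin n → k)) : Basis (Fin n) k' (Fin n → k') :=
  (Algebra.TensorProduct.basis k' b).map (TensorProduct.piScalarRight k k' k' (Fin n))

theorem extendBasis_apply (b : Basis (Fin n) k (Fin n → k)) (i : Fin n) :
    extendBasis k' b i = fun j => algebraMap k k' (b i j) := by
  ext j
  simp [extendBasis, Algebra.algebraMap_eq_smul_one]

theorem extendBasis_repr (b : Basis (Fin n) k (Fin n → k)) (x : Fin n → k) (i : Fin n) :
    (extendBasis k' b).repr (fun j => algebraMap k k' (x j)) i = algebraMap k k' (b.repr x i) := by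
  have h : (fun j => algebraMap k k' (x j)) =
      ∑ l, algebraMap k k' (b.repr x l) • extendBasis k' b l := by
    ext j
    conv_lhs => rw [← b.sum_repr x]
    simp [extendBasis_apply, Finset.sum_apply, Algebra.smul_def]
  rw [h, Basis.repr_sum_self]

/-- The values `max_i |a i| * N (x i)` for all expressions `w = ∑ i, a i • x i` of a vector `w`
of `k' ^ n` with `a i ∈ k'` and `x i ∈ k ^ n`. -/
def tensorValues (N : Seminorm k (Fin n → k)) (w : Fin n → k') : Set ℝ :=
  {r | ∃ (m : ℕ) (a : Fin m → k') (x : Fin m → Fin n → k),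
    w = ∑ i, a i • (fun j => algebraMap k k' (x i j)) ∧ r = ⨆ i, ‖a i‖ * N (x i)}

/-- The extension of scalars `N ⊗ 1` of a norm `N` on `k ^ n` to `k' ^ n`. -/
def tensorFun (N : Seminorm k (Fin n → k)) (w : Fin n → k') : ℝ := sInf (tensorValues N w)

theorem tensorFun_eq [IsUltrametricDist k'] {N : Seminorm k (Fin n → k)}
    {b : Basis (Fin n) k (Fin n → k)} {c : Fin n → ℝ} (h : ∀ v, N v = diagFun b c v)
    (w : Fin n → k') : tensorFun N w = diagFun (extendBasis k' b) c w := by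
  apply IsLeast.csInf_eq
  constructor
  · refine ⟨n, fun i => (extendBasis k' b).repr w i, fun i => b i, ?_, ?_⟩
    · conv_lhs => rw [← (extendBasis k' b).sum_repr w]
      simp only [extendBasis_apply]
    · simp only [h, diagFun_basis]
      unfold diagFun
      simp only [mul_comm]
  · rintro r ⟨m, a, x, rfl, rfl⟩
    have hnn : 0 ≤ ⨆ i, ‖a i‖ * N (x i) :=
      Real.iSup_nonneg fun i => mul_nonneg (norm_nonneg _) (apply_nonneg _ _)
    refine diagFun_le hnn fun i => ?_
    rw [← le_div_iff₀' (Real.exp_pos _)]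
    simp only [map_sum, map_smul, Finsupp.finsetSum_apply, Finsupp.smul_apply, extendBasis_repr,
      smul_eq_mul]
    refine IsUltrametricDist.norm_sum_le_of_forall_le_of_nonneg
      (div_nonneg hnn (Real.exp_pos _).le) fun l _ => ?_
    rw [le_div_iff₀' (Real.exp_pos _), norm_mul, norm_algebraMap']
    calc Real.exp (c i) * (‖a l‖ * ‖b.repr (x l) i‖)
        = ‖a l‖ * (Real.exp (c i) * ‖b.repr (x l) i‖) := by ring
      _ ≤ ‖a l‖ * N (x l) := by
          rw [h]
          exact mul_le_mul_of_nonneg_left (le_diagFun b c (x l) i) (norm_nonneg _)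
      _ ≤ ⨆ l, ‖a l‖ * N (x l) :=
          le_ciSup (f := fun l => ‖a l‖ * N (x l)) (Set.finite_range _).bddAbove l

/-- Extension of scalars of diagonalizable norms. -/
def DiagNorms.baseChange (k' : Type*) [NormedField k'] [NormedAlgebra k k']
    [IsUltrametricDist k'] (N : DiagNorms n k) : DiagNorms n k' :=
  ⟨Seminorm.of (tensorFun N.1)
    (by
      obtain ⟨b, c, h⟩ := N.2
      intro v w
      simp only [tensorFun_eq h]
      exact map_add_le_add (diagSeminorm (extendBasis k' b) c) v w)
    (by
      obtain ⟨b, c, h⟩ := N.2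
      intro a w
      simp only [tensorFun_eq h]
      exact diagFun_smul _ _ _ _),
    by
      obtain ⟨b, c, h⟩ := N.2
      exact ⟨extendBasis k' b, c, fun w => tensorFun_eq h w⟩⟩

theorem tensorFun_homothety {N N' : Seminorm k (Fin n → k)} {a : ℝ} (ha : 0 < a)
    (h : ∀ v, N v = a * N' v) (w : Fin n → k') : tensorFun N w = a * tensorFun N' w := by
  have hs : tensorValues N w = a • tensorValues N' w := by
    ext r
    simp only [tensorValues, Set.mem_smul_set, Set.mem_ofPred_eq, smul_eq_mul]
    constructor
    · rintro ⟨m, t, x, hw, rfl⟩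
      refine ⟨_, ⟨m, t, x, hw, rfl⟩, ?_⟩
      rw [Real.mul_iSup_of_nonneg ha.le]
      simp only [h, mul_left_comm]
    · rintro ⟨_, ⟨m, t, x, hw, rfl⟩, rfl⟩
      refine ⟨m, t, x, hw, ?_⟩
      rw [Real.mul_iSup_of_nonneg ha.le]
      simp only [h, mul_left_comm]
  rw [tensorFun, tensorFun, hs, Real.sInf_smul_of_nonneg ha.le, smul_eq_mul]

/-- The natural map `B(SL_n, k) → B(SL_n, k')` given by functoriality of the building. -/
def Building.baseChange (n : ℕ) (k k' : Type*) [NormedField k] [NormedField k']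
    [NormedAlgebra k k'] [IsUltrametricDist k'] : Building n k → Building n k' :=
  Quotient.map (sa := homothety n k) (sb := homothety n k') (DiagNorms.baseChange k')
    fun _ _ ⟨a, ha, h⟩ => ⟨a, ha, tensorFun_homothety ha h⟩

end BaseChange

section Galois

variable {n : ℕ} {k k' : Type*} [NontriviallyNormedField k] [CompleteSpace k]
  [IsUltrametricDist k] [NormedField k'] [NormedAlgebra k k'] [Algebra.IsAlgebraic k k']

set_option linter.unusedSectionVars false

theorem norm_galois (σ : k' ≃ₐ[k] k') (x : k') : ‖σ x‖ = ‖x‖ := by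
  rw [NormedAlgebra.norm_eq_spectralNorm k, NormedAlgebra.norm_eq_spectralNorm k]
  exact (spectralNorm_eq_of_equiv σ x).symm

/-- The transform of a basis of `k' ^ n` by a Galois automorphism acting on coordinates. -/
def conjBasis (σ : k' ≃ₐ[k] k') (b : Basis (Fin n) k' (Fin n → k')) :
    Basis (Fin n) k' (Fin n → k') :=
  Basis.ofEquivFun
    { toFun := fun v i => σ (b.repr (fun j => σ.symm (v j)) i)
      invFun := fun a j => σ (b.equivFun.symm (fun i => σ.symm (a i)) j)
      map_add' := fun v w => by
        ext i
        have : (fun j => σ.symm ((v + w) j)) =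
            (fun j => σ.symm (v j)) + fun j => σ.symm (w j) := by
          ext j; simp
        rw [this]; simp
      map_smul' := fun a v => by
        ext i
        have : (fun j => σ.symm ((a • v) j)) = σ.symm a • fun j => σ.symm (v j) := by
          ext j; simp
        rw [this]; simp
      left_inv := fun v => by
        ext j
        have : (fun i => σ.symm (σ (b.repr (fun j => σ.symm (v j)) i))) =
            b.equivFun (fun j => σ.symm (v j)) := by
          ext i; simp
        simp only [this, LinearEquiv.symm_apply_apply, AlgEquiv.apply_symm_apply]
      right_inv := fun a => by
        ext i
        simp only [AlgEquiv.symm_apply_apply]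
        have : b.repr (b.equivFun.symm fun i => σ.symm (a i)) i = σ.symm (a i) := by
          rw [← Basis.equivFun_apply, LinearEquiv.apply_symm_apply]
        exact (congrArg σ this).trans (σ.apply_symm_apply _) }

theorem conjBasis_repr (σ : k' ≃ₐ[k] k') (b : Basis (Fin n) k' (Fin n → k'))
    (v : Fin n → k') (i : Fin n) :
    (conjBasis σ b).repr v i = σ (b.repr (fun j => σ.symm (v j)) i) := by
  rw [← Basis.equivFun_apply, conjBasis, Basis.equivFun_ofEquivFun]
  rfl

/-- The Galois action on norms on `k' ^ n`: `(σ N) v = N (σ⁻¹ v)`, where `σ⁻¹` acts on `k' ^ n`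
coordinatewise. -/
def DiagNorms.galois (σ : k' ≃ₐ[k] k') (N : DiagNorms n k') : DiagNorms n k' :=
  ⟨Seminorm.of (fun v => N.1 (fun j => σ.symm (v j)))
    (fun v w => by
      have : (fun j => σ.symm ((v + w) j)) =
          (fun j => σ.symm (v j)) + fun j => σ.symm (w j) := by
        ext j; simp
      rw [this]
      exact map_add_le_add N.1 _ _)
    (fun a v => by
      have : (fun j => σ.symm ((a • v) j)) = σ.symm a • fun j => σ.symm (v j) := by
        ext j; simp
      rw [this, map_smul_eq_mul, norm_galois]),
    by
      obtain ⟨b, c, h⟩ := N.2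
      refine ⟨conjBasis σ b, c, fun v => ?_⟩
      simp only [diagFun, conjBasis_repr, norm_galois]
      exact h _⟩

/-- The action of `Gal(k'/k)` on the building `B(SL_n, k')`. -/
instance Building.galoisAction : MulAction (k' ≃ₐ[k] k') (Building n k') where
  smul σ := Quotient.map (sa := homothety n k') (sb := homothety n k') (DiagNorms.galois σ)
    fun _ _ ⟨a, ha, h⟩ => ⟨a, ha, fun _ => h _⟩
  one_smul x := by
    induction x using Quotient.inductionOn
    rfl
  mul_smul σ τ x := by
    induction x using Quotient.inductionOn
    rfl

end Galois

section Valuations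

/-- The group of values `|K ^ ×|`. -/
def valueGroup (K : Type*) [NormedField K] : Subgroup ℝˣ :=
  (Units.map (normHom : K →*₀ ℝ).toMonoidHom).range

/-- The absolute value of `K` is discrete and non-trivial: `|K ^ ×|` is infinite cyclic,
generated by the absolute value of an element `π`. -/
def IsDiscretelyValued (K : Type*) [NormedField K] : Prop :=
  ∃ π : K, 0 < ‖π‖ ∧ ‖π‖ < 1 ∧ ∀ x : K, x ≠ 0 → ∃ m : ℤ, ‖x‖ = ‖π‖ ^ m

/-- The extension `k'/k` is totally ramified: its ramification index, which is the index of
`|k ^ ×|` in `|k' ^ ×|`, is equal to its (finite) degree. -/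
def IsTotallyRamified (k k' : Type*) [NormedField k] [NormedField k'] [NormedAlgebra k k'] :
    Prop :=
  (valueGroup k).relIndex (valueGroup k') = finrank k k'

/-- The characteristic of the residue field of a non-Archimedean field. -/
def residueChar (K : Type*) [NormedField K] [IsUltrametricDist K] : ℕ :=
  ringChar (IsLocalRing.ResidueField (NormedField.valuation (K := K)).valuationSubring)

end Valuations

end

end GoldmanIwahori

/-! Restricting a norm to `k ^ n` undoes extension of scalars, so the map of buildings is injective.
A fixed homothety class consists of Galois-invariant norms, since the scaling factor of each
automorphism is a positive real of finite order. Extended norms are invariant because automorphisms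
preserve absolute values.

Tame case (degree of absolute value 1). Total ramification gives a basis `B` of `k'/k` with absolute
values in distinct cosets of `|k ^ ×|`. For an invariant norm `N` and `w = ∑ B i • x i`, let `l`
maximize `‖B i‖ * N (x i)`. In the trace of `(B l)⁻¹ • w` the `l`-th term is the degree times `x l`,
and it strictly dominates: a trace lies in `k`, so its absolute value cannot equal `‖B m / B l‖`.
Hence `B` is orthogonal for `N`, and `N` is the extension of its restriction
(`norm_mul_le_of_galois_invariant`). The restriction is diagonalizable by discreteness.

Wild case (residue characteristic `p` divides the degree). Some `x` has `‖x‖` outside `|k|` but `‖x‖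
^ p` in it. As the residue field does not grow, `(σ x / x) ^ p` is a principal unit, hence so is `σ
x / x`, and `x` is closer to its conjugates than to `k`. A ball around `x` of intermediate radius
gives a fixed point not coming from `k` (`exists_mem_fixedPoints_notMem_range`). -/

namespace GoldmanIwahori

open Module

/-! ### Sums in ultrametric spaces. -/

section Ultrametric

variable {K V ι : Type*} [NormedField K] [AddCommGroup V] [Module K V]

theorem sum_le_of_ultrametric {N : Seminorm K V} (hN : ∀ v w, N (v + w) ≤ max (N v) (N w))
    (s : Finset ι) (f : ι → V) {r : ℝ} (hr : 0 ≤ r) (h : ∀ i ∈ s, N (f i) ≤ r) :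
    N (∑ i ∈ s, f i) ≤ r := by
  classical
  induction s using Finset.induction_on with
  | empty => simpa using hr
  | insert i s hi ih =>
    rw [Finset.sum_insert hi]
    exact (hN _ _).trans (max_le (h i (Finset.mem_insert_self i s))
      (ih fun j hj => h j (Finset.mem_insert_of_mem hj)))

theorem sum_lt_of_ultrametric {N : Seminorm K V} (hN : ∀ v w, N (v + w) ≤ max (N v) (N w))
    (s : Finset ι) (f : ι → V) {r : ℝ} (hr : 0 < r) (h : ∀ i ∈ s, N (f i) < r) :
    N (∑ i ∈ s, f i) < r := by
  classical
  induction s using Finset.induction_on with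
  | empty => simpa using hr
  | insert i s hi ih =>
    rw [Finset.sum_insert hi]
    exact (hN _ _).trans_lt (max_lt (h i (Finset.mem_insert_self i s))
      (ih fun j hj => h j (Finset.mem_insert_of_mem hj)))

theorem add_eq_left_of_ultrametric {N : Seminorm K V}
    (hN : ∀ v w, N (v + w) ≤ max (N v) (N w)) {v w : V} (h : N w < N v) : N (v + w) = N v := by
  apply le_antisymm ((hN v w).trans (max_le le_rfl h.le))
  have h1 := hN (v + w) (-w)
  rw [add_neg_cancel_right, map_neg_eq_map] at h1
  rcases le_max_iff.1 h1 with h2 | h2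
  · exact h2
  · exact absurd h2 (not_le.2 h)

/-- In an ultrametric space, a sum with a strictly dominant term has the size of that term. -/
theorem sum_eq_of_dominant [Fintype ι] [DecidableEq ι] {N : Seminorm K V}
    (hN : ∀ v w, N (v + w) ≤ max (N v) (N w)) (f : ι → V) (i : ι) (hi : 0 < N (f i))
    (h : ∀ j, j ≠ i → N (f j) < N (f i)) : N (∑ j, f j) = N (f i) := by
  rw [← Finset.add_sum_erase _ _ (Finset.mem_univ i)]
  exact add_eq_left_of_ultrametric hN
    (sum_lt_of_ultrametric hN _ _ hi fun j hj => h j (Finset.ne_of_mem_erase hj))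

theorem norm_sum_eq_of_dominant [IsUltrametricDist K] [Fintype ι] [DecidableEq ι] (f : ι → K)
    (i : ι) (hi : f i ≠ 0) (h : ∀ j, j ≠ i → ‖f j‖ < ‖f i‖) : ‖∑ j, f j‖ = ‖f i‖ :=
  sum_eq_of_dominant (N := normSeminorm K K) IsUltrametricDist.norm_add_le_max f i
    (norm_pos_iff.2 hi) h

end Ultrametric

/-! ### Residue characteristic and principal units. -/

section ResidueChar

variable (K : Type*) [NormedField K] [IsUltrametricDist K]

theorem residueChar_dvd_iff (m : ℕ) : residueChar K ∣ m ↔ ‖(m : K)‖ < 1 := by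
  rw [residueChar, ← ringChar.spec, ← map_natCast (IsLocalRing.residue _),
    IsLocalRing.residue_eq_zero_iff, Valuation.mem_maximalIdeal_iff]
  rfl

theorem norm_natCast_eq_one {m : ℕ} (h : ¬ residueChar K ∣ m) : ‖(m : K)‖ = 1 :=
  le_antisymm (IsUltrametricDist.norm_natCast_le_one K m)
    (not_lt.1 fun h1 => h ((residueChar_dvd_iff K m).2 h1))

/-- This disposes of residue characteristic 0, which divides only 0. -/
theorem residueChar_prime {m : ℕ} (hm : m ≠ 0) (h : residueChar K ∣ m) :
    (residueChar K).Prime := by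
  rcases CharP.char_is_prime_or_zero
    (IsLocalRing.ResidueField (NormedField.valuation (K := K)).valuationSubring)
    (residueChar K) (hc := ringChar.charP _) with h1 | h1
  · exact h1
  · rw [h1, zero_dvd_iff] at h
    exact absurd h hm

variable {K}

/-- In residue characteristic `p`, a `p`-th root of a principal unit is a principal unit. -/
theorem norm_sub_one_lt_one {p : ℕ} (hp : p.Prime) (hpK : ‖(p : K)‖ < 1) {u : K}
    (hu : ‖u‖ ≤ 1) (h : ‖u ^ p - 1‖ < 1) : ‖u - 1‖ < 1 := by
  let R := (NormedField.valuation (K := K)).valuationSubring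
  have hmem (x : K) : x ∈ R ↔ ‖x‖ ≤ 1 := Iff.rfl
  have hu1 : u - 1 ∈ R := sub_mem ((hmem u).2 hu) (one_mem R)
  obtain ⟨r, hr⟩ := exists_add_pow_prime_eq hp (1 : R) ⟨u - 1, hu1⟩
  have hr' := congrArg (Subtype.val : R → K) hr
  push_cast at hr'
  rw [add_sub_cancel, one_pow, mul_one, mul_assoc] at hr'
  have hs : ‖(u - 1) * (r : K)‖ ≤ 1 := (hmem _).1 (mul_mem hu1 r.2)
  -- Expanding `u = 1 + (u - 1)`: the middle binomial terms are divisible by `p`, which is small.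
  have key : (u - 1) ^ p = (u ^ p - 1) - p * ((u - 1) * r) := by rw [hr']; ring
  have : ‖u - 1‖ ^ p < 1 := by
    rw [← norm_pow, key]
    rw [sub_eq_add_neg]
    refine (IsUltrametricDist.norm_add_le_max _ _).trans_lt (max_lt h ?_)
    rw [norm_neg, norm_mul]
    exact (mul_le_of_le_one_right (norm_nonneg _) hs).trans_lt hpK
  exact (pow_lt_one_iff_of_nonneg (norm_nonneg _) hp.ne_zero).1 this

end ResidueChar

/-! ### Value groups and bases of totally ramified extensions. -/

section Ramification

variable {k k' : Type*} [NormedField k] [NormedField k'] [NormedAlgebra k k']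

theorem mem_valueGroup_iff {K : Type*} [NormedField K] {g : ℝˣ} :
    g ∈ valueGroup K ↔ ∃ x : K, ‖x‖ = g := by
  constructor
  · rintro ⟨x, rfl⟩
    exact ⟨x, rfl⟩
  · rintro ⟨x, hx⟩
    have h0 : x ≠ 0 := norm_ne_zero_iff.1 (hx ▸ g.ne_zero)
    exact ⟨Units.mk0 x h0, Units.ext hx⟩

/-- The absolute value of a non-zero element, as an element of the value group. -/
noncomputable def valueOf {K : Type*} [NormedField K] (x : Kˣ) : valueGroup K :=
  ⟨Units.map (normHom : K →*₀ ℝ).toMonoidHom x, x, rfl⟩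

theorem coe_valueOf {K : Type*} [NormedField K] (x : Kˣ) : ((valueOf x : ℝˣ) : ℝ) = ‖(x : K)‖ :=
  rfl

theorem valueOf_surjective {K : Type*} [NormedField K] :
    Function.Surjective (valueOf : Kˣ → valueGroup K) := by
  rintro ⟨_, x, rfl⟩
  exact ⟨x, rfl⟩

theorem IsTotallyRamified.card_quotient (h : IsTotallyRamified k k') :
    Nat.card (valueGroup k' ⧸ (valueGroup k).subgroupOf (valueGroup k')) = finrank k k' :=
  h

/-- An infinite index would be recorded as 0, whereas the degree is positive. -/
theorem IsTotallyRamified.finite_quotient [FiniteDimensional k k'] (h : IsTotallyRamified k k') :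
    Finite (valueGroup k' ⧸ (valueGroup k).subgroupOf (valueGroup k')) :=
  Nat.finite_of_card_ne_zero (h.card_quotient ▸ finrank_pos.ne')

theorem IsTotallyRamified.exists_norm_pow_eq (h : IsTotallyRamified k k') {x : k'} (hx : x ≠ 0) :
    ∃ y : k, ‖x‖ ^ finrank k k' = ‖y‖ := by
  have h1 := ((valueGroup k).subgroupOf (valueGroup k')).pow_index_mem (valueOf (Units.mk0 x hx))
  rw [Subgroup.index, h.card_quotient, Subgroup.mem_subgroupOf, mem_valueGroup_iff] at h1
  obtain ⟨y, hy⟩ := h1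
  exact ⟨y, by simpa [coe_valueOf] using hy.symm⟩

variable [FiniteDimensional k k']

/-- Cauchy's theorem in `|k' ^ ×| / |k ^ ×|`, whose order is the degree. -/
theorem IsTotallyRamified.exists_norm_pow_prime_eq (h : IsTotallyRamified k k') {p : ℕ}
    (hp : p.Prime) (hpn : p ∣ finrank k k') :
    ∃ x : k', (∀ y : k, ‖x‖ ≠ ‖y‖) ∧ ∃ y : k, ‖x‖ ^ p = ‖y‖ := by
  have := h.finite_quotient
  have : Fact p.Prime := ⟨hp⟩
  obtain ⟨q, hq⟩ := exists_prime_orderOf_dvd_card' p (h.card_quotient ▸ hpn)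
  obtain ⟨g, rfl⟩ := QuotientGroup.mk_surjective q
  obtain ⟨x, rfl⟩ := valueOf_surjective g
  refine ⟨x, fun y hy => ?_, ?_⟩
  · have h1 : ((valueOf x : valueGroup k') :
        valueGroup k' ⧸ (valueGroup k).subgroupOf (valueGroup k')) = 1 := by
      rw [QuotientGroup.eq_one_iff, Subgroup.mem_subgroupOf, mem_valueGroup_iff]
      exact ⟨y, hy.symm⟩
    rw [h1, orderOf_one] at hq
    exact hp.one_lt.ne hq
  · have h1 := hq ▸ pow_orderOf_eq_one ((valueOf x : valueGroup k') :
        valueGroup k' ⧸ (valueGroup k).subgroupOf (valueGroup k'))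
    rw [← QuotientGroup.mk_pow, QuotientGroup.eq_one_iff, Subgroup.mem_subgroupOf,
      mem_valueGroup_iff] at h1
    obtain ⟨y, hy⟩ := h1
    exact ⟨y, by simpa [coe_valueOf] using hy.symm⟩

/-- Representatives of `|k' ^ ×| / |k ^ ×|` in `k'`, one of which is `1`. -/
theorem IsTotallyRamified.exists_representatives (h : IsTotallyRamified k k') :
    ∃ a : Fin (finrank k k') → k', (∀ i, a i ≠ 0) ∧ (∃ i, a i = 1) ∧
      ∀ i j, i ≠ j → ∀ y : k, ‖a i / a j‖ ≠ ‖y‖ := by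
  have := h.finite_quotient
  have hsec (q : valueGroup k' ⧸ (valueGroup k).subgroupOf (valueGroup k')) :
      ∃ a : k'ˣ, QuotientGroup.mk (valueOf a) = q ∧ (q = 1 → a = 1) := by
    by_cases hq : q = 1
    · refine ⟨1, ?_, fun _ => rfl⟩
      have : valueOf (1 : k'ˣ) = 1 := by ext; simp [coe_valueOf]
      rw [this, hq]; rfl
    · obtain ⟨g, rfl⟩ := QuotientGroup.mk_surjective q
      obtain ⟨x, rfl⟩ := valueOf_surjective g
      exact ⟨x, rfl, fun h1 => absurd h1 hq⟩
  choose a ha ha1 using hsec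
  let e := (Finite.equivFinOfCardEq h.card_quotient).symm
  refine ⟨fun i => a (e i), fun i => (a (e i)).ne_zero, ⟨e.symm 1, by simp [ha1 1 rfl]⟩,
    fun i j hij y hy => hij (e.injective ?_)⟩
  rw [← ha (e i), ← ha (e j), eq_comm, QuotientGroup.eq, Subgroup.mem_subgroupOf,
    mem_valueGroup_iff]
  refine ⟨y, hy.symm.trans ?_⟩
  rw [norm_div, div_eq_inv_mul]
  simp [coe_valueOf]

/-- Two nonzero terms of equal size would put `‖a i / a j‖` in `|k|`, so the largest term is unique.
-/
theorem exists_dominant {k k' ι : Type*} [NormedField k] [NormedField k'] [NormedAlgebra k k']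
    [IsUltrametricDist k'] [Fintype ι] {a : ι → k'} (ha : ∀ i, a i ≠ 0)
    (hne : ∀ i j, i ≠ j → ∀ y : k, ‖a i / a j‖ ≠ ‖y‖) {g : ι → k} (hg : ∃ i, g i ≠ 0) :
    ∃ i, g i ≠ 0 ∧ ‖∑ j, g j • a j‖ = ‖g i • a i‖ ∧ ∀ j, j ≠ i → ‖g j • a j‖ < ‖g i • a i‖ := by
  classical
  obtain ⟨i0, hi0⟩ := hg
  have : Nonempty ι := ⟨i0⟩
  obtain ⟨i, hi⟩ := Finite.exists_max fun i => ‖g i • a i‖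
  have hpos : 0 < ‖g i • a i‖ := by
    refine lt_of_lt_of_le ?_ (hi i0)
    rw [norm_pos_iff]
    exact smul_ne_zero hi0 (ha i0)
  have hgi : g i ≠ 0 := fun h0 => by simp [h0] at hpos
  have hlt : ∀ j, j ≠ i → ‖g j • a j‖ < ‖g i • a i‖ := by
    refine fun j hj => lt_of_le_of_ne (hi j) fun heq => hne i j hj.symm (g j / g i) ?_
    rw [norm_smul, norm_smul] at heq
    rw [norm_div, norm_div, div_eq_div_iff (norm_ne_zero_iff.2 (ha j)) (norm_ne_zero_iff.2 hgi),
      heq, mul_comm]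
  exact ⟨i, hgi, norm_sum_eq_of_dominant _ i (norm_pos_iff.1 hpos) hlt, hlt⟩

variable [IsUltrametricDist k']

/-- A totally ramified extension has a basis whose members have absolute values in distinct
cosets of `|k ^ ×|`. -/
theorem IsTotallyRamified.exists_basis (h : IsTotallyRamified k k') :
    ∃ B : Basis (Fin (finrank k k')) k k', (∃ i, B i = 1) ∧
      ∀ i j, i ≠ j → ∀ y : k, ‖B i / B j‖ ≠ ‖y‖ := by
  obtain ⟨a, ha, ha1, hne⟩ := h.exists_representatives
  have hli : LinearIndependent k a := by
    rw [Fintype.linearIndependent_iff]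
    intro g hg
    by_contra! hcon
    obtain ⟨i, hi, heq, -⟩ := exists_dominant ha hne hcon
    rw [hg, norm_zero, eq_comm, norm_eq_zero] at heq
    exact smul_ne_zero hi (ha i) heq
  have : Nonempty (Fin (finrank k k')) := ⟨ha1.choose⟩
  refine ⟨basisOfLinearIndependentOfCardEqFinrank hli (by simp), ?_, ?_⟩ <;>
    rwa [coe_basisOfLinearIndependentOfCardEqFinrank]

/-- A totally ramified extension does not change the residue field. -/
theorem IsTotallyRamified.exists_norm_sub_lt (h : IsTotallyRamified k k') {z : k'} (hz : z ≠ 0)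
    {y : k} (hzy : ‖z‖ = ‖y‖) : ∃ t : k, ‖z - algebraMap k k' t‖ < ‖z‖ := by
  classical
  obtain ⟨B, ⟨i1, hi1⟩, hne⟩ := h.exists_basis
  have hrep : ∃ i, B.repr z i ≠ 0 := by
    by_contra! hcon
    exact hz (B.repr.map_eq_zero_iff.1 (Finsupp.ext hcon))
  obtain ⟨i, hi, heq, hlt⟩ := exists_dominant B.ne_zero hne hrep
  rw [B.sum_repr] at heq
  -- Since `‖z‖` lies in `|k|`, the dominant basis vector is the one equal to 1, so the dominant
  -- term lies in `k`.
  have hi1' : i = i1 := by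
    by_contra hii
    refine hne i i1 hii (y / B.repr z i) ?_
    rw [norm_div y, ← hzy, heq, norm_smul, hi1, div_one,
      mul_div_cancel_left₀ _ (norm_ne_zero_iff.2 hi)]
  subst hi1'
  refine ⟨B.repr z i, ?_⟩
  have h1 : z - algebraMap k k' (B.repr z i) = ∑ j ∈ Finset.univ.erase i, B.repr z j • B j := by
    rw [sub_eq_iff_eq_add', Algebra.algebraMap_eq_smul_one, ← hi1,
      Finset.add_sum_erase _ (fun j => B.repr z j • B j) (Finset.mem_univ i), B.sum_repr]
  rw [h1]
  exact sum_lt_of_ultrametric (N := normSeminorm k' k') IsUltrametricDist.norm_add_le_max _ _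
    (norm_pos_iff.2 hz) fun j hj => heq ▸ hlt j (Finset.ne_of_mem_erase hj)

end Ramification

/-! ### Norms on the plane in coordinates. -/

section Coordinates

variable {K : Type*} [NormedField K]

theorem diagFun_two (b : Basis (Fin 2) K (Fin 2 → K)) (c : Fin 2 → ℝ) (v : Fin 2 → K) :
    diagFun b c v = max (Real.exp (c 0) * ‖b.repr v 0‖) (Real.exp (c 1) * ‖b.repr v 1‖) := by
  apply le_antisymm
  · refine diagFun_le (le_max_of_le_left (by positivity)) fun i => ?_
    fin_cases i
    · exact le_max_left _ _
    · exact le_max_right _ _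
  · exact max_le (le_diagFun b c v 0) (le_diagFun b c v 1)

/-- The basis `(1, 0), (t, 1)` of `K ^ 2`. -/
noncomputable def shearBasis (t : K) : Basis (Fin 2) K (Fin 2 → K) :=
  Basis.ofEquivFun
    { toFun := fun v => ![v 0 - t * v 1, v 1]
      invFun := fun v => ![v 0 + t * v 1, v 1]
      map_add' := fun v w => by
        ext i; fin_cases i
        · simp; ring
        · simp
      map_smul' := fun a v => by
        ext i; fin_cases i
        · simp; ring
        · simp
      left_inv := fun v => by ext i; fin_cases i <;> simp
      right_inv := fun v => by ext i; fin_cases i <;> simp }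

theorem shearBasis_repr (t : K) (v : Fin 2 → K) :
    ⇑((shearBasis t).repr v) = ![v 0 - t * v 1, v 1] := by
  rw [← Basis.equivFun_apply, shearBasis, Basis.equivFun_ofEquivFun]
  rfl

theorem diagFun_shearBasis (t : K) (c : Fin 2 → ℝ) (v : Fin 2 → K) :
    diagFun (shearBasis t) c v =
      max (Real.exp (c 0) * ‖v 0 - t * v 1‖) (Real.exp (c 1) * ‖v 1‖) := by
  simp [diagFun_two, shearBasis_repr]

theorem IsDiagonalizable.exists_norm_apply_le {n : ℕ} {N : Seminorm K (Fin n → K)}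
    (hN : IsDiagonalizable N) (j : Fin n) : ∃ C : ℝ, 0 < C ∧ ∀ v, ‖v j‖ ≤ C * N v := by
  obtain ⟨b, c, h⟩ := hN
  -- The summand 1 only makes the constant positive.
  refine ⟨∑ i, (Real.exp (c i))⁻¹ * ‖b i j‖ + 1, by positivity, fun v => ?_⟩
  have hv : v j = ∑ i, b.repr v i * b i j := by
    conv_lhs => rw [← b.sum_repr v]
    simp
  have h0 : 0 ≤ N v := apply_nonneg _ _
  calc ‖v j‖ ≤ ∑ i, ‖b.repr v i * b i j‖ := hv ▸ norm_sum_le _ _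
    _ ≤ ∑ i, (Real.exp (c i))⁻¹ * ‖b i j‖ * N v := by
        refine Finset.sum_le_sum fun i _ => ?_
        have h1 := le_diagFun b c v i
        rw [← h, ← le_div_iff₀' (Real.exp_pos _)] at h1
        calc ‖b.repr v i * b i j‖ ≤ N v / Real.exp (c i) * ‖b i j‖ := by
              rw [norm_mul]; gcongr
          _ = (Real.exp (c i))⁻¹ * ‖b i j‖ * N v := by ring
    _ ≤ _ := by rw [← Finset.sum_mul]; nlinarith

end Coordinates

/-! ### Discreteness of the values of a norm. -/

section Discrete

theorem finite_setOf_zpow_mem_Icc {ρ A B : ℝ} (h0 : 0 < ρ) (h1 : ρ < 1) (hA : 0 < A) :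
    {m : ℤ | ρ ^ m ∈ Set.Icc A B}.Finite := by
  obtain ⟨s, hs⟩ := exists_pow_lt_of_lt_one hA h1
  obtain ⟨t, ht⟩ := pow_unbounded_of_one_lt B ((one_lt_inv₀ h0).2 h1)
  refine (Set.finite_Icc (-(t : ℤ)) s).subset ?_
  rintro m ⟨hm1, hm2⟩
  constructor
  · by_contra! hlt
    have := (zpow_le_zpow_iff_right_of_lt_one₀ h0 h1).2 hlt.le
    rw [zpow_neg, zpow_natCast, ← inv_pow] at this
    linarith
  · by_contra! hlt
    have := (zpow_le_zpow_iff_right_of_lt_one₀ h0 h1).2 hlt.le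
    rw [zpow_natCast] at this
    linarith

variable {n : ℕ} {k k' : Type*} [NormedField k] [NormedField k'] [NormedAlgebra k k']

/-- Raising to the degree moves absolute values of `k'` into `|k|`, so these powers of values of `N`
lie in finitely many cosets of the powers of `‖π‖`. -/
theorem IsDiagonalizable.exists_value_pow_eq (hram : IsTotallyRamified k k') {π : k}
    (hπ : ∀ x : k, x ≠ 0 → ∃ m : ℤ, ‖x‖ = ‖π‖ ^ m) {N : Seminorm k' (Fin n → k')}
    {b : Basis (Fin n) k' (Fin n → k')} {c : Fin n → ℝ} (h : ∀ v, N v = diagFun b c v)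
    {v : Fin n → k'} (hv : N v ≠ 0) :
    ∃ (i : Fin n) (m : ℤ),
      N v ^ finrank k k' = Real.exp (c i) ^ finrank k k' * ‖π‖ ^ m := by
  have : Nonempty (Fin n) := by
    by_contra hcon
    rw [not_nonempty_iff] at hcon
    exact hv (by rw [h, diagFun, Real.iSup_of_isEmpty])
  obtain ⟨i, hi⟩ := exists_eq_ciSup_of_finite (f := fun i => Real.exp (c i) * ‖b.repr v i‖)
  have hi' : Real.exp (c i) * ‖b.repr v i‖ = N v := hi.trans (h v).symm
  have h0 : b.repr v i ≠ 0 := fun h0 => hv (by rw [← hi', h0, norm_zero, mul_zero])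
  obtain ⟨y, hy⟩ := hram.exists_norm_pow_eq h0
  have hy0 : y ≠ 0 := by
    rintro rfl
    rw [norm_zero] at hy
    exact h0 (norm_eq_zero.1 (eq_zero_of_pow_eq_zero hy))
  obtain ⟨m, hm⟩ := hπ y hy0
  exact ⟨i, m, by rw [← hi', mul_pow, hy, hm]⟩

/-- A diagonalizable norm over a discretely valued field reaches its infimum on any non-empty set
of vectors on which it is bounded below by a positive number. -/
theorem IsDiagonalizable.exists_min [FiniteDimensional k k'] (hdisc : IsDiscretelyValued k)
    (hram : IsTotallyRamified k k') {N : Seminorm k' (Fin n → k')} (hN : IsDiagonalizable N)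
    {S : Set (Fin n → k')} (hS : S.Nonempty) {ε : ℝ} (hε : 0 < ε) (hSε : ∀ v ∈ S, ε ≤ N v) :
    ∃ v ∈ S, ∀ w ∈ S, N v ≤ N w := by
  obtain ⟨π, hπ0, hπ1, hπ⟩ := hdisc
  obtain ⟨b, c, h⟩ := hN
  obtain ⟨v₀, hv₀⟩ := hS
  set d := finrank k k' with hd
  have hd0 : d ≠ 0 := finrank_pos.ne'
  -- The possible `d`-th powers of values of `N` between `ε` and `N v₀`.
  let F : Set ℝ := ⋃ i : Fin n, (fun m : ℤ => Real.exp (c i) ^ d * ‖π‖ ^ m) ''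
    {m : ℤ | ‖π‖ ^ m ∈ Set.Icc (ε ^ d / Real.exp (c i) ^ d) (N v₀ ^ d / Real.exp (c i) ^ d)}
  have hF : F.Finite := Set.finite_iUnion fun i =>
    (finite_setOf_zpow_mem_Icc hπ0 hπ1 (by positivity)).image _
  have hG : (Set.Ici (0 : ℝ) ∩ (fun r => r ^ d) ⁻¹' F).Finite := by
    refine Set.Finite.of_finite_image (f := fun r => r ^ d)
      (hF.subset (Set.image_subset_iff.2 Set.inter_subset_right)) ?_
    rintro r ⟨hr, -⟩ s ⟨hs, -⟩ hrs
    exact (pow_left_inj₀ hr hs hd0).1 hrs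
  have hT : (N '' S ∩ Set.Iic (N v₀)).Finite := by
    refine hG.subset ?_
    rintro _ ⟨⟨v, hv, rfl⟩, hvv⟩
    refine ⟨apply_nonneg N v, ?_⟩
    obtain ⟨i, m, him⟩ := IsDiagonalizable.exists_value_pow_eq hram hπ h
      (hε.trans_le (hSε v hv)).ne'
    refine Set.mem_iUnion.2 ⟨i, m, ?_, him.symm⟩
    have he : (0 : ℝ) < Real.exp (c i) ^ d := by positivity
    have hm : ‖π‖ ^ m = N v ^ d / Real.exp (c i) ^ d := by
      rw [him, mul_div_cancel_left₀ _ he.ne']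
    rw [Set.mem_ofPred_eq, hm, Set.mem_Icc, div_le_div_iff_of_pos_right he,
      div_le_div_iff_of_pos_right he]
    exact ⟨pow_le_pow_left₀ hε.le (hSε v hv) d, pow_le_pow_left₀ (apply_nonneg N v) hvv d⟩
  obtain ⟨r, ⟨⟨v, hv, rfl⟩, hvv⟩, hmin⟩ :=
    hT.exists_minimal ⟨N v₀, ⟨v₀, hv₀, rfl⟩, Set.self_mem_Iic⟩
  refine ⟨v, hv, fun w hw => ?_⟩
  rcases le_total (N w) (N v₀) with hle | hle
  · rcases le_total (N v) (N w) with h1 | h1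
    · exact h1
    · exact hmin ⟨⟨w, hw, rfl⟩, hle⟩ h1
  · exact le_trans hvv hle

end Discrete

/-! ### Restriction of norms, and injectivity of the map. -/

section Restriction

variable {n : ℕ} {k k' : Type*} [NormedField k] [NormedField k'] [NormedAlgebra k k']

/-- The restriction to `k ^ n` of a seminorm on `k' ^ n`. -/
def restrictNorm (k : Type*) {k' : Type*} [NormedField k] [NormedField k'] [NormedAlgebra k k']
    (N : Seminorm k' (Fin n → k')) : Seminorm k (Fin n → k) :=
  Seminorm.of (fun v => N fun j => algebraMap k k' (v j))
    (fun v w => by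
      have : (fun j => algebraMap k k' ((v + w) j)) =
          (fun j => algebraMap k k' (v j)) + fun j => algebraMap k k' (w j) := by
        ext j; simp
      rw [this]
      exact map_add_le_add N _ _)
    (fun a v => by
      have : (fun j => algebraMap k k' ((a • v) j)) =
          algebraMap k k' a • fun j => algebraMap k k' (v j) := by
        ext j; simp
      rw [this, map_smul_eq_mul, norm_algebraMap'])

theorem restrictNorm_apply (N : Seminorm k' (Fin n → k')) (v : Fin n → k) :
    restrictNorm k N v = N fun j => algebraMap k k' (v j) :=
  rfl

/-- If `t` in `k` minimizes `N ![t, 1]`, then `(1, 0), (t, 1)` is adapted to the restriction. The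
infimum is attained by discreteness, being positive because the second coordinate is 1. -/
theorem isDiagonalizable_restrictNorm [FiniteDimensional k k'] [IsUltrametricDist k']
    (hdisc : IsDiscretelyValued k)
    (hram : IsTotallyRamified k k') {N : Seminorm k' (Fin 2 → k')} (hN : IsDiagonalizable N) :
    IsDiagonalizable (restrictNorm k N) := by
  obtain ⟨C, hC, hle⟩ := hN.exists_norm_apply_le 1
  obtain ⟨_, ⟨t, rfl⟩, ht⟩ := hN.exists_min hdisc hram
    (S := Set.range fun t : k => ![algebraMap k k' t, 1]) (Set.range_nonempty _) (inv_pos.2 hC)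
    (by
      rintro _ ⟨t, rfl⟩
      have := hle ![algebraMap k k' t, 1]
      rw [inv_le_iff_one_le_mul₀' hC]
      simpa using this)
  have hpos {v : Fin 2 → k'} (hv : v ≠ 0) : 0 < N v :=
    lt_of_le_of_ne (apply_nonneg _ _) fun h0 => hv (hN.eq_zero h0.symm)
  have h0 : 0 < N ![1, 0] := hpos fun h => by simpa using congrFun h 0
  have h1 : 0 < N ![algebraMap k k' t, 1] := hpos fun h => by simpa using congrFun h 1
  refine ⟨shearBasis t, ![Real.log (N ![1, 0]), Real.log (N ![algebraMap k k' t, 1])],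
    fun v => ?_⟩
  rw [diagFun_shearBasis, restrictNorm_apply]
  simp only [Matrix.cons_val_zero, Matrix.cons_val_one, Real.exp_log h0, Real.exp_log h1]
  set x := v 0 - t * v 1 with hx
  set y := v 1 with hy
  have hv : (fun j => algebraMap k k' (v j)) =
      algebraMap k k' x • ![(1 : k'), 0] + algebraMap k k' y • ![algebraMap k k' t, 1] := by
    ext j
    fin_cases j
    · simp [hx, Algebra.smul_def]; ring
    · simp [hy, Algebra.smul_def]
  have hx' : N (algebraMap k k' x • ![(1 : k'), 0]) = N ![1, 0] * ‖x‖ := by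
    rw [map_smul_eq_mul, norm_algebraMap', mul_comm]
  have hy' : N (algebraMap k k' y • ![algebraMap k k' t, 1]) =
      N ![algebraMap k k' t, 1] * ‖y‖ := by
    rw [map_smul_eq_mul, norm_algebraMap', mul_comm]
  apply le_antisymm
  · rw [hv, ← hx', ← hy']
    exact hN.add_le_max _ _
  · have hge : N ![algebraMap k k' t, 1] * ‖y‖ ≤ N fun j => algebraMap k k' (v j) := by
      by_cases hy0 : y = 0
      · simp [hy0]
      · have h2 : (fun j => algebraMap k k' (v j)) =
            algebraMap k k' y • ![algebraMap k k' (v 0 / y), 1] := by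
          ext j
          fin_cases j
          · simp [mul_div_cancel₀, hy0]
          · simp [hy]
        rw [h2, map_smul_eq_mul, norm_algebraMap', mul_comm]
        exact mul_le_mul_of_nonneg_left (ht _ ⟨_, rfl⟩) (norm_nonneg _)
    -- The first component is `v` minus the second component, so the ultrametric inequality bounds
    -- it too.
    refine max_le ?_ hge
    rw [← hx', eq_sub_of_add_eq hv.symm, sub_eq_add_neg]
    refine (hN.add_le_max _ _).trans (max_le le_rfl ?_)
    rw [map_neg_eq_map, hy']
    exact hge

theorem restrictNorm_baseChange [IsUltrametricDist k'] (N : DiagNorms n k) (v : Fin n → k) :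
    restrictNorm k (N.baseChange k').1 v = N.1 v := by
  obtain ⟨b, c, h⟩ := N.2
  refine (tensorFun_eq h _).trans ?_
  rw [h]
  simp only [diagFun, extendBasis_repr, norm_algebraMap']

theorem baseChange_injective [IsUltrametricDist k'] :
    Function.Injective (Building.baseChange n k k') := by
  rintro ⟨N⟩ ⟨N'⟩ hNN
  obtain ⟨a, ha, h⟩ := Quotient.exact hNN
  refine Quotient.sound ⟨a, ha, fun v => ?_⟩
  rw [← restrictNorm_baseChange (k' := k') N, ← restrictNorm_baseChange (k' := k') N']
  exact h _

/-- Extension of scalars is the largest ultrametric norm with a given restriction. -/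
theorem le_tensorFun_restrictNorm {N : Seminorm k' (Fin n → k')}
    (hN : ∀ v w, N (v + w) ≤ max (N v) (N w)) (w : Fin n → k') :
    N w ≤ tensorFun (restrictNorm k N) w := by
  refine le_csInf ⟨_, n, w, fun i => Pi.single i 1, ?_, rfl⟩ ?_
  · ext j
    simp [Finset.sum_apply, Pi.single_apply, apply_ite (algebraMap k k')]
  · rintro _ ⟨m, a, x, rfl, rfl⟩
    refine sum_le_of_ultrametric hN _ _
      (Real.iSup_nonneg fun i => mul_nonneg (norm_nonneg _) (apply_nonneg _ _)) fun i _ => ?_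
    rw [map_smul_eq_mul]
    exact le_ciSup (f := fun i => ‖a i‖ * restrictNorm k N (x i)) (Set.finite_range _).bddAbove i

theorem tensorFun_le {N : Seminorm k (Fin n → k)} {m : ℕ} (a : Fin m → k') (x : Fin m → Fin n → k)
    {r : ℝ} (hr : 0 ≤ r) (h : ∀ i, ‖a i‖ * N (x i) ≤ r) :
    tensorFun N (∑ i, a i • fun j => algebraMap k k' (x i j)) ≤ r := by
  have hbdd : BddBelow (tensorValues N (∑ i, a i • fun j => algebraMap k k' (x i j))) := by
    refine ⟨0, ?_⟩
    rintro _ ⟨m, a, x, -, rfl⟩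
    exact Real.iSup_nonneg fun i => mul_nonneg (norm_nonneg _) (apply_nonneg _ _)
  exact (csInf_le hbdd ⟨m, a, x, rfl, rfl⟩).trans (Real.iSup_le h hr)

end Restriction

/-- The homothety class of a diagonalizable norm. -/
def DiagNorms.toBuilding {n : ℕ} {K : Type*} [NormedField K] (N : DiagNorms n K) : Building n K :=
  Quotient.mk _ N

/-! ### Fixed classes and invariant norms. -/

section GaloisInvariance

variable {n : ℕ} {k k' : Type*} [NontriviallyNormedField k] [CompleteSpace k]
  [IsUltrametricDist k] [NormedField k'] [NormedAlgebra k k'] [FiniteDimensional k k']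

theorem galois_smul_toBuilding (σ : k' ≃ₐ[k] k') (N : DiagNorms n k') :
    σ • N.toBuilding = (N.galois σ).toBuilding :=
  rfl

theorem toBuilding_mem_fixedPoints {N : DiagNorms n k'}
    (h : ∀ (σ : k' ≃ₐ[k] k') (v : Fin n → k'), N.1 (fun j => σ (v j)) = N.1 v) :
    N.toBuilding ∈
      MulAction.fixedPoints (k' ≃ₐ[k] k') (Building n k') := by
  intro σ
  rw [galois_smul_toBuilding]
  exact Quotient.sound ⟨1, one_pos, fun v => (h σ.symm v).trans (one_mul _).symm⟩

/-- A norm whose homothety class is fixed by the Galois group is Galois-invariant. -/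
theorem apply_galois_of_mem_fixedPoints {N : DiagNorms n k'}
    (h : N.toBuilding ∈
      MulAction.fixedPoints (k' ≃ₐ[k] k') (Building n k'))
    (σ : k' ≃ₐ[k] k') (v : Fin n → k') : N.1 (fun j => σ (v j)) = N.1 v := by
  have h1 := h σ⁻¹
  rw [galois_smul_toBuilding] at h1
  obtain ⟨a, ha, hNa⟩ := Quotient.exact h1
  have hNa' (w : Fin n → k') : N.1 (fun j => σ (w j)) = a * N.1 w := hNa w
  have hpow (m : ℕ) : N.1 (fun j => (σ ^ m) (v j)) = a ^ m * N.1 v := by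
    induction m with
    | zero => simp
    | succ m ih =>
      have : (fun j => (σ ^ (m + 1)) (v j)) = fun j => σ ((σ ^ m) (v j)) := by
        ext j; rw [pow_succ', AlgEquiv.mul_apply]
      rw [this, hNa', ih, pow_succ', mul_assoc]
  have h2 := hpow (orderOf σ)
  rw [pow_orderOf_eq_one] at h2
  rw [hNa']
  by_cases hv : N.1 v = 0
  · rw [hv, mul_zero]
  -- The Galois group is finite, so the positive scaling factor `a` is a root of unity, hence 1.
  · have h3 : a ^ orderOf σ = 1 := by
      refine mul_right_cancel₀ hv ?_
      rw [one_mul, ← h2]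
      rfl
    rw [(pow_eq_one_iff_of_nonneg ha.le (orderOf_pos σ).ne').1 h3, one_mul]

theorem range_baseChange_subset_fixedPoints [IsUltrametricDist k'] :
    Set.range (Building.baseChange n k k') ⊆
      MulAction.fixedPoints (k' ≃ₐ[k] k') (Building n k') := by
  rintro _ ⟨⟨N⟩, rfl⟩
  refine toBuilding_mem_fixedPoints fun σ w => ?_
  obtain ⟨b, c, h⟩ := N.2
  refine (tensorFun_eq h _).trans (Eq.trans ?_ (tensorFun_eq h _).symm)
  have hw : (fun j => σ (w j)) = ∑ i, σ ((extendBasis k' b).repr w i) • extendBasis k' b i := by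
    ext j
    conv_lhs => rw [← (extendBasis k' b).sum_repr w]
    simp [extendBasis_apply, Finset.sum_apply]
  simp only [diagFun]
  rw [hw]
  simp only [Basis.repr_sum_self, norm_galois]

end GaloisInvariance

/-! ### The tame case: descent by the trace. -/

section Tame

variable {n : ℕ} {k k' : Type*} [NontriviallyNormedField k] [CompleteSpace k]
  [IsUltrametricDist k] [NormedField k'] [IsUltrametricDist k'] [NormedAlgebra k k']
  [FiniteDimensional k k'] [IsGalois k k']

theorem norm_trace_le (x : k') : ‖Algebra.trace k k' x‖ ≤ ‖x‖ := by
  rw [← norm_algebraMap' k', trace_eq_sum_automorphisms]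
  exact IsUltrametricDist.norm_sum_le_of_forall_le_of_nonneg (norm_nonneg _)
    fun σ _ => (norm_galois σ x).le

/-- The trace does not increase a Galois-invariant ultrametric norm. -/
theorem apply_sum_galois_le {k k' : Type*} [NontriviallyNormedField k] [NormedField k']
    [NormedAlgebra k k'] [FiniteDimensional k k'] [IsGalois k k'] {N : Seminorm k' (Fin n → k')}
    (hN : ∀ v w, N (v + w) ≤ max (N v) (N w))
    (hinv : ∀ (σ : k' ≃ₐ[k] k') (v : Fin n → k'), N (fun j => σ (v j)) = N v)
    (v : Fin n → k') : N (fun j => algebraMap k k' (Algebra.trace k k' (v j))) ≤ N v := by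
  have : (fun j => algebraMap k k' (Algebra.trace k k' (v j))) =
      ∑ σ : k' ≃ₐ[k] k', fun j => σ (v j) := by
    ext j
    rw [trace_eq_sum_automorphisms, Finset.sum_apply]
  rw [this]
  exact sum_le_of_ultrametric hN _ _ (apply_nonneg _ _) fun σ _ => (hinv σ v).le

/-- In the tame case, a basis adapted to the absolute value of `k'` is adapted to every
Galois-invariant norm. -/
theorem norm_mul_le_of_galois_invariant (htame : ‖(finrank k k' : k)‖ = 1)
    {ι : Type*} [Fintype ι] (B : Basis ι k k')
    (hB : ∀ i j, i ≠ j → ∀ y : k, ‖B i / B j‖ ≠ ‖y‖) {N : Seminorm k' (Fin n → k')}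
    (hN : ∀ v w, N (v + w) ≤ max (N v) (N w))
    (hinv : ∀ (σ : k' ≃ₐ[k] k') (v : Fin n → k'), N (fun j => σ (v j)) = N v)
    (x : ι → Fin n → k) (i : ι) :
    ‖B i‖ * restrictNorm k N (x i) ≤ N (∑ i, B i • fun j => algebraMap k k' (x i j)) := by
  classical
  have : Nonempty ι := ⟨i⟩
  obtain ⟨l, hl⟩ := Finite.exists_max fun i => ‖B i‖ * restrictNorm k N (x i)
  refine (hl i).trans ?_
  set w := ∑ i, B i • fun j => algebraMap k k' (x i j) with hw
  have hBpos (i : ι) : 0 < ‖B i‖ := norm_pos_iff.2 (B.ne_zero i)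
  rcases (apply_nonneg (restrictNorm k N) (x l)).eq_or_lt with h0 | hpos
  · rw [← h0, mul_zero]
    exact apply_nonneg _ _
  -- The terms of the trace of `(B l)⁻¹ • w`.
  set g : ι → Fin n → k := fun m => Algebra.trace k k' (B m / B l) • x m with hg
  have hgl : restrictNorm k N (g l) = restrictNorm k N (x l) := by
    have : Algebra.trace k k' (B l / B l) = finrank k k' := by
      rw [div_self (B.ne_zero l), ← map_one (algebraMap k k'), Algebra.trace_algebraMap,
        nsmul_eq_mul, mul_one]
    rw [hg, map_smul_eq_mul, this, htame, one_mul]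
  have hlt (m : ι) (hm : m ≠ l) : restrictNorm k N (g m) < restrictNorm k N (g l) := by
    rw [hgl, hg, map_smul_eq_mul]
    rcases (apply_nonneg (restrictNorm k N) (x m)).eq_or_lt with h0 | hpos'
    · rwa [← h0, mul_zero]
    · have h1 : ‖Algebra.trace k k' (B m / B l)‖ < ‖B m / B l‖ :=
        lt_of_le_of_ne (norm_trace_le _) fun h => hB m l hm _ h.symm
      refine (mul_lt_mul_of_pos_right h1 hpos').trans_le ?_
      rw [norm_div, div_mul_eq_mul_div, div_le_iff₀' (hBpos l)]
      exact hl m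
  have hsum : (fun j => algebraMap k k' (Algebra.trace k k' (((B l)⁻¹ • w) j))) =
      fun j => algebraMap k k' ((∑ m, g m) j) := by
    ext j
    congr 1
    simp only [hw, hg, Pi.smul_apply, Finset.sum_apply, smul_eq_mul, Finset.mul_sum, map_sum]
    refine Finset.sum_congr rfl fun m _ => ?_
    rw [mul_comm (Algebra.trace k k' _), ← smul_eq_mul (x m j), ← map_smul, Algebra.smul_def]
    congr 1
    ring
  have hres : ∀ v w, restrictNorm k N (v + w) ≤ max (restrictNorm k N v) (restrictNorm k N w) := by
    intro v w
    simp only [restrictNorm_apply]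
    convert hN (fun j => algebraMap k k' (v j)) (fun j => algebraMap k k' (w j)) using 2
    ext j
    simp
  have h1 := apply_sum_galois_le hN hinv ((B l)⁻¹ • w)
  rw [hsum, ← restrictNorm_apply, sum_eq_of_dominant hres g l (hgl ▸ hpos) hlt, hgl,
    map_smul_eq_mul, norm_inv, le_inv_mul_iff₀ (hBpos l)] at h1
  exact h1

theorem fixedPoints_subset_range_baseChange (hdisc : IsDiscretelyValued k)
    (hram : IsTotallyRamified k k') (htame : ‖(finrank k k' : k)‖ = 1) :
    MulAction.fixedPoints (k' ≃ₐ[k] k') (Building 2 k') ⊆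
      Set.range (Building.baseChange 2 k k') := by
  rintro ⟨N⟩ hfix
  have hinv := apply_galois_of_mem_fixedPoints (N := N) hfix
  obtain ⟨B, -, hB⟩ := hram.exists_basis
  refine ⟨Quotient.mk _ ⟨restrictNorm k N.1, isDiagonalizable_restrictNorm hdisc hram N.2⟩,
    Quotient.sound ⟨1, one_pos, fun w => ?_⟩⟩
  rw [one_mul]
  refine le_antisymm ?_ (le_tensorFun_restrictNorm N.2.add_le_max w)
  have hw : w = ∑ i, B i • fun j => algebraMap k k' (B.repr (w j) i) := by
    ext j
    conv_lhs => rw [← B.sum_repr (w j)]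
    simp only [Finset.sum_apply, Pi.smul_apply, smul_eq_mul]
    exact Finset.sum_congr rfl fun i _ => by rw [Algebra.smul_def, mul_comm]
  have h1 := norm_mul_le_of_galois_invariant htame B hB N.2.add_le_max hinv
    fun i j => B.repr (w j) i
  rw [← hw] at h1
  have h2 := tensorFun_le (N := restrictNorm k N.1) B (fun i j => B.repr (w j) i)
    (apply_nonneg N.1 w) h1
  rw [← hw] at h2
  exact h2

end Tame

/-! ### The wild case: a fixed point not defined over `k`. -/

section Wild

variable {k k' : Type*} [NontriviallyNormedField k] [CompleteSpace k]
  [IsUltrametricDist k] [NormedField k'] [IsUltrametricDist k'] [NormedAlgebra k k']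
  [FiniteDimensional k k']

/-- In the wild case, some element of `k'` is closer to its conjugates than to `k`. -/
theorem exists_norm_galois_sub_lt (hram : IsTotallyRamified k k')
    (hwild : residueChar k ∣ finrank k k') :
    ∃ x : k', (∀ y : k, ‖x‖ ≠ ‖y‖) ∧ ∀ σ : k' ≃ₐ[k] k', ‖σ x - x‖ < ‖x‖ := by
  set p := residueChar k with hp
  have hprime : p.Prime := residueChar_prime k finrank_pos.ne' hwild
  have hpk' : ‖(p : k')‖ < 1 := by
    rw [← map_natCast (algebraMap k k'), norm_algebraMap']
    exact (residueChar_dvd_iff k p).1 dvd_rfl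
  obtain ⟨x, hx, y, hxy⟩ := hram.exists_norm_pow_prime_eq hprime hwild
  refine ⟨x, hx, fun σ => ?_⟩
  have hx0 : x ≠ 0 := fun h0 => hx 0 (by simp [h0])
  have hxp : x ^ p ≠ 0 := pow_ne_zero p hx0
  obtain ⟨t, ht⟩ := hram.exists_norm_sub_lt hxp ((norm_pow x p).trans hxy)
  have hu : ‖σ x / x‖ = 1 := by
    rw [norm_div, norm_galois, div_self (norm_ne_zero_iff.2 hx0)]
  have hup : ‖(σ x / x) ^ p - 1‖ < 1 := by
    -- As `σ` fixes `t`, it moves `x ^ p` only by the difference of two small errors.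
    have h1 : (σ x / x) ^ p - 1 =
        (σ (x ^ p - algebraMap k k' t) + -(x ^ p - algebraMap k k' t)) / x ^ p := by
      rw [map_sub, map_pow, AlgEquiv.commutes, div_pow, div_sub_one hxp]
      congr 1
      ring
    rw [h1, norm_div, div_lt_one (norm_pos_iff.2 hxp)]
    refine (IsUltrametricDist.norm_add_le_max _ _).trans_lt (max_lt ?_ ?_)
    · rwa [norm_galois]
    · rwa [norm_neg]
  have h2 := norm_sub_one_lt_one hprime hpk' hu.le hup
  rwa [div_sub_one hx0, norm_div, div_lt_one (norm_pos_iff.2 hx0)] at h2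

/-- The class of `(v₀, v₁) ↦ max (|v₀ - x v₁|, r |v₁|)` is Galois-fixed when `x` is at distance at
most `r` from its conjugates, and it is not defined over `k` when `x` is at distance more than `r`
from `k`. -/
theorem exists_mem_fixedPoints_notMem_range {x : k'} (hx : ∀ y : k, ‖x‖ ≠ ‖y‖)
    (hσ : ∀ σ : k' ≃ₐ[k] k', ‖σ x - x‖ < ‖x‖) :
    ∃ P ∈ MulAction.fixedPoints (k' ≃ₐ[k] k') (Building 2 k'),
      P ∉ Set.range (Building.baseChange 2 k k') := by
  have hxpos : 0 < ‖x‖ := norm_pos_iff.2 fun h0 => hx 0 (by simp [h0])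
  obtain ⟨r, hr0, hrx, hr⟩ : ∃ r, 0 < r ∧ r < ‖x‖ ∧ ∀ σ : k' ≃ₐ[k] k', ‖σ x - x‖ ≤ r := by
    obtain ⟨τ, hτ⟩ := Finite.exists_max fun σ : k' ≃ₐ[k] k' => ‖σ x - x‖
    -- The term `‖x‖ / 2` keeps `r` positive even if every `σ` fixes `x`.
    exact ⟨max (‖x‖ / 2) ‖τ x - x‖, lt_max_of_lt_left (half_pos hxpos),
      max_lt (half_lt_self hxpos) (hσ τ), fun σ => (hτ σ).trans (le_max_right _ _)⟩
  let c : Fin 2 → ℝ := ![0, Real.log r]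
  let N : DiagNorms 2 k' := ⟨diagSeminorm (shearBasis x) c, shearBasis x, c, fun _ => rfl⟩
  have hNv (v : Fin 2 → k') : N.1 v = max ‖v 0 - x * v 1‖ (r * ‖v 1‖) := by
    refine (diagFun_shearBasis x c v).trans ?_
    simp [c, Real.exp_log hr0]
  have hle (σ : k' ≃ₐ[k] k') (v : Fin 2 → k') : N.1 (fun j => σ (v j)) ≤ N.1 v := by
    simp only [hNv, norm_galois]
    refine max_le ?_ (le_max_right _ _)
    have h1 : σ (v 0) - x * σ (v 1) = σ (v 0 - x * v 1) + (σ x - x) * σ (v 1) := by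
      simp only [map_sub, map_mul]
      ring
    rw [h1]
    refine (IsUltrametricDist.norm_add_le_max _ _).trans (max_le_max ?_ ?_)
    · rw [norm_galois]
    · rw [norm_mul, norm_galois]
      exact mul_le_mul_of_nonneg_right (hr σ) (norm_nonneg _)
  refine ⟨N.toBuilding, toBuilding_mem_fixedPoints fun σ v => (hle σ v).antisymm ?_, ?_⟩
  · simpa using hle σ.symm fun j => σ (v j)
  rintro ⟨⟨N'⟩, hNN⟩
  obtain ⟨a, ha, h⟩ := Quotient.exact hNN
  -- Over `k` the sizes of `v 0` and `x * v 1` differ unless `v 1 = 0`, so no cancellation occurs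
  -- and the restriction is diagonal in the standard basis, with weights `a` and `a * ‖x‖`.
  have hN' (v : Fin 2 → k) :
      N'.1 v = diagFun (shearBasis 0) ![Real.log a, Real.log (a * ‖x‖)] v := by
    rw [← restrictNorm_baseChange (k' := k'), diagFun_shearBasis, restrictNorm_apply, h, hNv]
    simp only [Matrix.cons_val_zero, Matrix.cons_val_one, Real.exp_log ha,
      Real.exp_log (mul_pos ha hxpos), zero_mul, sub_zero, norm_algebraMap', mul_assoc]
    rw [← mul_max_of_nonneg _ _ ha.le]
    congr 1
    by_cases hv : v 1 = 0
    · simp [hv]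
    have hne : ‖algebraMap k k' (v 0)‖ ≠ ‖-(x * algebraMap k k' (v 1))‖ := by
      rw [norm_neg, norm_mul, norm_algebraMap', norm_algebraMap']
      intro heq
      refine hx (v 0 / v 1) ?_
      rw [norm_div, heq, mul_div_cancel_right₀ _ (norm_ne_zero_iff.2 hv)]
    rw [sub_eq_add_neg, IsUltrametricDist.norm_add_eq_max_of_norm_ne_norm hne, norm_neg, norm_mul,
      norm_algebraMap', norm_algebraMap', max_eq_left]
    exact le_max_of_le_right (mul_le_mul_of_nonneg_right hrx.le (norm_nonneg _))
  -- At `![x, 1]` the norm `N` takes the value `r`, whereas the extension forces at least `‖x‖`.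
  have h1 : a * N.1 ![x, 1] = _ := (h ![x, 1]).symm.trans (tensorFun_eq hN' ![x, 1])
  have h2 := le_diagFun (extendBasis k' (shearBasis (0 : k)))
    ![Real.log a, Real.log (a * ‖x‖)] ![x, 1] 1
  have hsum : ![x, 1] = ∑ i, ![x, 1] i • extendBasis k' (shearBasis (0 : k)) i := by
    ext j
    have hb (i : Fin 2) : shearBasis (0 : k) i = Pi.single i 1 := by
      apply (shearBasis (0 : k)).repr.injective
      ext l
      rw [Basis.repr_self, shearBasis_repr]
      fin_cases i <;> fin_cases l <;> simp
    fin_cases j <;> simp [extendBasis_apply, hb]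
  have hrepr : (extendBasis k' (shearBasis (0 : k))).repr ![x, 1] 1 = 1 := by
    rw [hsum, Basis.repr_sum_self]
    rfl
  rw [← h1, hNv, hrepr] at h2
  simp only [Matrix.cons_val_zero, Matrix.cons_val_one, Real.exp_log (mul_pos ha hxpos), mul_one,
    sub_self, norm_zero, norm_one, max_eq_right hr0.le] at h2
  exact absurd (le_of_mul_le_mul_left h2 ha) (not_le.2 hrx)

end Wild

end GoldmanIwahori

theorem mainTheorem8 (k k' : Type*)
    [NontriviallyNormedField k] [CompleteSpace k] [IsUltrametricDist k]
    [NormedField k'] [IsUltrametricDist k'] [NormedAlgebra k k']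
    [FiniteDimensional k k'] [IsGalois k k']
    (hdisc : GoldmanIwahori.IsDiscretelyValued k)
    (hram : GoldmanIwahori.IsTotallyRamified k k') :
    Function.Injective (GoldmanIwahori.Building.baseChange 2 k k') ∧
    Set.range (GoldmanIwahori.Building.baseChange 2 k k') ⊆
      MulAction.fixedPoints (k' ≃ₐ[k] k') (GoldmanIwahori.Building 2 k') ∧
    (Set.range (GoldmanIwahori.Building.baseChange 2 k k') ⊂
        MulAction.fixedPoints (k' ≃ₐ[k] k') (GoldmanIwahori.Building 2 k') ↔
      GoldmanIwahori.residueChar k ∣ Module.finrank k k') := by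
  refine ⟨GoldmanIwahori.baseChange_injective, GoldmanIwahori.range_baseChange_subset_fixedPoints,
    fun h => ?_, fun h => ⟨GoldmanIwahori.range_baseChange_subset_fixedPoints, fun hsub => ?_⟩⟩
  · by_contra hndvd
    exact h.2 (GoldmanIwahori.fixedPoints_subset_range_baseChange hdisc hram
      (GoldmanIwahori.norm_natCast_eq_one k hndvd))
  · obtain ⟨x, hx, hσ⟩ := GoldmanIwahori.exists_norm_galois_sub_lt hram h
    obtain ⟨P, hP, hP'⟩ := GoldmanIwahori.exists_mem_fixedPoints_notMem_range hx hσ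
    exact hP' (hsub hP)
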